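/- Let $G=GL_n(\mathbb{C})$, let $V$ be a finite-dimensional complex representation of $G$, and let $\mathbb{P}(V)$ be the projective space of lines through the origin in $V$, with the induced action of $G$ and with the complex topology. Let $\mathbb{C}[V]=\bigoplus_d\mathbb{C}[V]_d$ be the coordinate ring of $V$ (polynomial functions on $V$, graded by degree), on which $G$ acts by $(\sigma\cdot f)(x)=f(\sigma^{-1}x)$. For $v\in\mathbb{P}(V)$ let $G_v=\{\sigma\in G:\sigma v=v\}$ be its stabilizer, let $\mathbb{C}v\subseteq V$ be the corresponding line, which is a one-dimensional representation of $G_v$, let $\Delta_V[v]=\overline{Gv}\subseteq\mathbb{P}(V)$ be the closure of the orbit of $v$ in the complex topology, and let $I_V[v]\subseteq\mathbb{C}[V]$ be the ideal of $\Delta_V[v]$, i.e. the ideal generated by the homogeneous forms that vanish on $\Delta_V[v]$. For $d\ge 0$ let $\Pi_v(d)$ be the set of all irreducible $G$-submodules $S\subseteq\mathbb{C}[V]_d$ whose dual $S^*$ contains no $G_v$-submodule isomorphic to $(\mathbb{C}v)^{\otimes d}$ (equivalently, to the dual of the $G_v$-module of degree $d$ forms on the line $\mathbb{C}v$), and let $\Pi_v=\bigcup_d\Pi_v(d)$.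 **Proposition.** Suppose that $v\in\mathbb{P}(V)$ is characterized by its stabilizer, i.e. $v$ is the only point of $\mathbb{P}(V)$ that is fixed by every element of $G_v$. Then every $S\in\Pi_v$ is contained in $I_V[v]$. -/

import Mathlib

open scoped LinearAlgebra.Projectivization TensorProduct

noncomputable section

namespace OrbitClosure

/-! ### The coordinate ring of a complex vector space -/

section CoordinateRing

variable (V : Type*) [AddCommGroup V] [Module ℂ V]

/-- The inclusion of the linear forms on `V` into the functions on `V`. -/
def linearForms : Module.Dual ℂ V →ₗ[ℂ] (V → ℂ) where
  toFun l := fun x => l x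
  map_add' _ _ := rfl
  map_smul' _ _ := rfl

/-- The coordinate ring `ℂ[V]`: the algebra of polynomial functions on `V`, that is, the algebra
of functions generated by the linear forms. -/
def coordRing : Subalgebra ℂ (V → ℂ) :=
  Algebra.adjoin ℂ (Set.range (linearForms V))

/-- Linear forms as elements of `ℂ[V]`. -/
def coordRing.ofDual : Module.Dual ℂ V →ₗ[ℂ] coordRing V :=
  (linearForms V).codRestrict (Subalgebra.toSubmodule (coordRing V))
    (fun l => Algebra.subset_adjoin ⟨l, rfl⟩)

/-- The homogeneous component `ℂ[V]_d`: the linear span of the products of `d` linear forms. -/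
def homogeneousPart (d : ℕ) : Submodule ℂ (coordRing V) :=
  LinearMap.range (coordRing.ofDual V) ^ d

variable {V}

/-- Composition with a linear endomorphism of `V`, as an endomorphism of the algebra of all
functions on `V`. -/
def precomp (A : V →ₗ[ℂ] V) : (V → ℂ) →ₐ[ℂ] (V → ℂ) where
  toFun f := fun x => f (A x)
  map_one' := rfl
  map_mul' _ _ := rfl
  map_zero' := rfl
  map_add' _ _ := rfl
  commutes' _ := rfl

theorem precomp_mem (A : V →ₗ[ℂ] V) {f : V → ℂ} (hf : f ∈ coordRing V) :
    precomp A f ∈ coordRing V := by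
  have h : coordRing V ≤ (coordRing V).comap (precomp A) := by
    refine Algebra.adjoin_le ?_
    rintro _ ⟨l, rfl⟩
    exact Algebra.subset_adjoin ⟨l.comp A, rfl⟩
  exact h hf

/-- The action of a group `G` on `ℂ[V]` induced by a representation on `V`:
`(σ • f) x = f (σ⁻¹ x)`. -/
def coordRep {G : Type*} [Group G] (ρ : Representation ℂ G V) :
    Representation ℂ G (coordRing V) where
  toFun σ :=
    { toFun := fun f => ⟨fun x => (f : V → ℂ) (ρ σ⁻¹ x), precomp_mem (ρ σ⁻¹) f.2⟩
      map_add' := fun _ _ => rfl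
      map_smul' := fun _ _ => rfl }
  map_one' := by
    ext f x
    simp
  map_mul' σ τ := by
    ext f x
    simp

end CoordinateRing

/-! ### Projective space, orbit closures and their ideals -/

section Projective

variable {V : Type*} [AddCommGroup V] [Module ℂ V]

/-- The complex topology on `ℙ(V)`: the quotient topology from `V ∖ {0}`. -/
instance projectiveTopology [TopologicalSpace V] : TopologicalSpace (ℙ ℂ V) :=
  TopologicalSpace.coinduced (fun w : { w : V // w ≠ 0 } => Projectivization.mk ℂ w.1 w.2)
    inferInstance

/-- The ideal in `ℂ[V]` of a subset `Y` of `ℙ(V)`: the ideal generated by the homogeneous forms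
that vanish at all points of `Y`. -/
def projectiveIdeal (Y : Set (ℙ ℂ V)) : Ideal (coordRing V) :=
  Ideal.span { f | (∃ d, f ∈ homogeneousPart V d) ∧
    ∀ (w : V) (hw : w ≠ 0), Projectivization.mk ℂ w hw ∈ Y → (f : V → ℂ) w = 0 }

variable {G : Type*} [Group G] (ρ : Representation ℂ G V)

/-- The orbit `Gv` in `ℙ(V)`. -/
def orbit (v : ℙ ℂ V) : Set (ℙ ℂ V) :=
  Set.range fun σ : G => ρ.asGroupHom σ • v

/-- The orbit closure `Δ_V[v]` in the complex topology of `ℙ(V)`. -/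
def orbitClosure [TopologicalSpace V] (v : ℙ ℂ V) : Set (ℙ ℂ V) :=
  closure (orbit ρ v)

/-- The ideal `I_V[v]` of the orbit closure `Δ_V[v]`. -/
def orbitClosureIdeal [TopologicalSpace V] (v : ℙ ℂ V) : Ideal (coordRing V) :=
  projectiveIdeal (orbitClosure ρ v)

/-- The stabilizer `G_v` of a point `v` of `ℙ(V)`. -/
def stabilizer (v : ℙ ℂ V) : Subgroup G where
  carrier := { σ | ρ.asGroupHom σ • v = v }
  one_mem' := by simp
  mul_mem' {a b} ha hb := by
    change ρ.asGroupHom (a * b) • v = v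
    change ρ.asGroupHom a • v = v at ha
    change ρ.asGroupHom b • v = v at hb
    rw [map_mul, mul_smul, hb, ha]
  inv_mem' {a} ha := by
    change ρ.asGroupHom a⁻¹ • v = v
    change ρ.asGroupHom a • v = v at ha
    rw [map_inv, inv_smul_eq_iff, ha]

theorem mem_stabilizer {v : ℙ ℂ V} {σ : G} :
    σ ∈ stabilizer ρ v ↔ ρ.asGroupHom σ • v = v := Iff.rfl

/-- `v` is characterized by its stabilizer: it is the only point of `ℙ(V)` fixed by `G_v`. -/
def CharacterizedByStabilizer (v : ℙ ℂ V) : Prop :=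
  ∀ w : ℙ ℂ V, (∀ h ∈ stabilizer ρ v, ρ.asGroupHom h • w = w) → w = v

/-! ### The representation-theoretic data of a point -/

theorem line_stable (v : ℙ ℂ V) (h : stabilizer ρ v) {x : V} (hx : x ∈ v.submodule) :
    ρ (h : G) x ∈ v.submodule := by
  have hv : ρ.asGroupHom (h : G) • v = v := h.2
  induction v using Projectivization.ind with
  | h w hw =>
    rw [Projectivization.generalLinearGroup_smul_def, Projectivization.map_mk,
      Projectivization.mk_eq_mk_iff'] at hv
    obtain ⟨a, ha⟩ := hv
    have ha' : a • w = ρ (h : G) w := ha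
    rw [Projectivization.submodule_mk, Submodule.mem_span_singleton] at hx ⊢
    obtain ⟨c, rfl⟩ := hx
    exact ⟨c * a, by rw [map_smul, ← ha', mul_smul]⟩

/-- The line `ℂv ⊆ V` as a representation of `G_v`. -/
def lineRep (v : ℙ ℂ V) : Representation ℂ (stabilizer ρ v) v.submodule where
  toFun h := (ρ (h : G)).restrict fun _ hx => line_stable ρ v h hx
  map_one' := by ext; simp
  map_mul' _ _ := by ext; simp

/-- The `d`-th tensor power of a representation. -/
def tensorPowerRep {H W : Type*} [Group H] [AddCommGroup W] [Module ℂ W]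
    (τ : Representation ℂ H W) (d : ℕ) : Representation ℂ H (⨂[ℂ]^d W) where
  toFun h := PiTensorProduct.map fun _ => τ h
  map_one' := by
    simp only [map_one]
    exact PiTensorProduct.map_one
  map_mul' g h := by
    simp only [map_mul]
    exact PiTensorProduct.map_mul _ _

/-- The restriction of a representation to a subgroup. -/
def restrictRep {W : Type*} [AddCommGroup W] [Module ℂ W] (τ : Representation ℂ G W)
    (H : Subgroup G) : Representation ℂ H W :=
  τ.comp H.subtype

/-- `Π_v(d)`: the irreducible `G`-submodules `S` of `ℂ[V]_d` whose dual `S^*` does not contain a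
`G_v`-submodule isomorphic to `(ℂv)^{⊗d}`. -/
def stabilizerData (v : ℙ ℂ V) (d : ℕ) : Set (Subrepresentation (coordRep ρ)) :=
  { S | S.toSubmodule ≤ homogeneousPart V d ∧
    Representation.IsIrreducible (k := ℂ) (G := G) (V := S.toSubmodule) S.toRepresentation ∧
    ¬ ∃ T : Subrepresentation (restrictRep S.toRepresentation.dual (stabilizer ρ v)),
      Nonempty (T.toRepresentation.Equiv (tensorPowerRep (lineRep ρ v) d)) }

end Projective

end OrbitClosure

end

/-!
If some form of degree `d` in `S` did not vanish at `x ∈ ℂv`, then evaluation at `x` would be a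
nonzero element of `S^*`. An element `h` of `G_v` acts on `ℂv` by a scalar `a`, hence multiplies
this evaluation by `a ^ d`, which is also how it acts on `(ℂv)^{⊗d}`; so the evaluation would span
a copy of `(ℂv)^{⊗d}` in `S^*`. Thus every form in `S` vanishes at `v`, hence on the orbit of `v`
because `S` is stable under `G`, and hence on its closure by continuity.
-/

namespace OrbitClosure

open Module

section LinearAlgebra

theorem finrank_piTensorProduct {R ι : Type*} [CommSemiring R] [StrongRankCondition R]
    [Fintype ι] (M : ι → Type*) [∀ i, AddCommMonoid (M i)] [∀ i, Module R (M i)]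
    [∀ i, Module.Free R (M i)] [∀ i, Module.Finite R (M i)] :
    finrank R (⨂[R] i, M i) = ∏ i, finrank R (M i) := by
  classical
  rw [finrank_eq_card_basis (Basis.piTensorProduct fun i => finBasis R (M i)), Fintype.card_pi]
  simp only [Fintype.card_fin]

theorem exists_subrepresentation_equiv_of_common_eigenvector {k H W L : Type*} [Field k] [Monoid H]
    [AddCommGroup W] [Module k W] [AddCommGroup L] [Module k L] (τ : Representation k H W)
    (χ : Representation k H L) (hL : finrank k L = 1) {u : W} (hu : u ≠ 0)
    (hτχ : ∀ h, ∃ a : k, τ h u = a • u ∧ χ h = a • LinearMap.id) :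
    ∃ T : Subrepresentation τ, Nonempty (T.toRepresentation.Equiv χ) := by
  have span_stable (h : H) : ∀ y ∈ k ∙ u, τ h y ∈ k ∙ u := by
    obtain ⟨a, hau, -⟩ := hτχ h
    intro y hy
    obtain ⟨c, rfl⟩ := Submodule.mem_span_singleton.1 hy
    rw [map_smul, hau, smul_smul]
    exact Submodule.smul_mem _ _ (Submodule.mem_span_singleton_self u)
  let T : Subrepresentation τ := ⟨k ∙ u, span_stable⟩
  have : FiniteDimensional k L := .of_finrank_eq_succ hL
  let e : T.toSubmodule ≃ₗ[k] L :=
    LinearEquiv.ofFinrankEq (k ∙ u) L ((finrank_span_singleton hu).trans hL.symm)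
  refine ⟨T, ⟨.mk e fun h => LinearMap.ext fun y => ?_⟩⟩
  obtain ⟨a, hau, haχ⟩ := hτχ h
  have T_apply : T.toRepresentation h y = a • y := by
    obtain ⟨c, hc⟩ := Submodule.mem_span_singleton.1 y.2
    refine Subtype.ext ?_
    change τ h y = a • (y : W)
    rw [← hc, map_smul, hau, smul_comm]
  change e (T.toRepresentation h y) = χ h (e y)
  rw [T_apply, haχ, map_smul, LinearMap.smul_apply, LinearMap.id_apply]

theorem tensorPowerRep_eq_smul_id {H W : Type*} [Group H] [AddCommGroup W] [Module ℂ W]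
    {τ : Representation ℂ H W} {h : H} {a : ℂ} (ha : τ h = a • LinearMap.id) (d : ℕ) :
    tensorPowerRep τ d h = a ^ d • LinearMap.id := by
  ext x
  change PiTensorProduct.map (fun _ => τ h) (PiTensorProduct.tprod ℂ x) =
    a ^ d • PiTensorProduct.tprod ℂ x
  rw [PiTensorProduct.map_tprod, ha]
  exact ((PiTensorProduct.tprod ℂ).map_smul_univ (fun _ => a) x).trans (by rw [Fin.prod_const])

end LinearAlgebra

section Forms

variable {V : Type*} [AddCommGroup V] [Module ℂ V]

theorem apply_smul_of_mem_homogeneousPart {d : ℕ} {f : coordRing V} (hf : f ∈ homogeneousPart V d)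
    (c : ℂ) (x : V) : (f : V → ℂ) (c • x) = c ^ d * (f : V → ℂ) x := by
  induction hf using Submodule.pow_induction_on_left' with
  | algebraMap r => simp [Pi.algebraMap_apply]
  | add f g i _ _ hf hg =>
    change (f : V → ℂ) (c • x) + (g : V → ℂ) (c • x) = c ^ i * ((f : V → ℂ) x + (g : V → ℂ) x)
    rw [hf, hg, mul_add]
  | mem_mul m hm i f _ hf =>
    obtain ⟨l, rfl⟩ := hm
    change l (c • x) * (f : V → ℂ) (c • x) = c ^ (i + 1) * (l x * (f : V → ℂ) x)
    rw [hf, map_smul, smul_eq_mul]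
    ring

theorem continuous_coordRing [FiniteDimensional ℂ V] [TopologicalSpace V]
    [IsTopologicalAddGroup V] [ContinuousSMul ℂ V] [T2Space V] (f : coordRing V) :
    Continuous (f : V → ℂ) := by
  obtain ⟨f, hf⟩ := f
  change Continuous f
  induction hf using Algebra.adjoin_induction with
  | mem f hf =>
    obtain ⟨l, rfl⟩ := hf
    exact l.continuous_of_finiteDimensional
  | algebraMap r => exact continuous_const
  | add f g _ _ hf hg => exact hf.add hg
  | mul f g _ _ hf hg => exact hf.mul hg

/-- The zero locus in `ℙ(V)` of a polynomial function, which need not be homogeneous: the set of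
lines on which the function vanishes identically. -/
def zeroLocus (f : coordRing V) : Set (ℙ ℂ V) :=
  { p | ∀ x ∈ p.submodule, (f : V → ℂ) x = 0 }

theorem mk_mem_zeroLocus_iff {f : coordRing V} {w : V} (hw : w ≠ 0) :
    Projectivization.mk ℂ w hw ∈ zeroLocus f ↔ ∀ c : ℂ, (f : V → ℂ) (c • w) = 0 := by
  simp only [zeroLocus, Set.mem_ofPred_eq, Projectivization.submodule_mk,
    Submodule.mem_span_singleton, forall_exists_index, forall_apply_eq_imp_iff]

theorem isClosed_zeroLocus [FiniteDimensional ℂ V] [TopologicalSpace V]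
    [IsTopologicalAddGroup V] [ContinuousSMul ℂ V] [T2Space V] (f : coordRing V) :
    IsClosed (zeroLocus f) := by
  rw [isClosed_coinduced]
  simp only [Set.preimage, mk_mem_zeroLocus_iff, Set.ofPred_forall]
  exact isClosed_iInter fun c => isClosed_eq
    ((continuous_coordRing f).comp (continuous_subtype_val.const_smul c)) continuous_const

theorem mem_projectiveIdeal_of_subset_zeroLocus {d : ℕ} {f : coordRing V}
    (hf : f ∈ homogeneousPart V d) {Y : Set (ℙ ℂ V)} (hY : Y ⊆ zeroLocus f) :
    f ∈ projectiveIdeal Y :=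
  Ideal.subset_span ⟨⟨d, hf⟩, fun w hw hwY => by
    simpa only [one_smul] using (mk_mem_zeroLocus_iff hw).1 (hY hwY) 1⟩

/-- Evaluation at the point `x`, as a linear form on a space `S` of polynomial functions. -/
def evalAt (S : Submodule ℂ (coordRing V)) (x : V) : Dual ℂ S :=
  LinearMap.proj x ∘ₗ (coordRing V).val.toLinearMap ∘ₗ S.subtype

theorem evalAt_smul {S : Submodule ℂ (coordRing V)} {d : ℕ} (hS : S ≤ homogeneousPart V d)
    (c : ℂ) (x : V) : evalAt S (c • x) = c ^ d • evalAt S x :=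
  LinearMap.ext fun f => apply_smul_of_mem_homogeneousPart (hS f.2) c x

end Forms

section Action

variable {V G : Type*} [AddCommGroup V] [Module ℂ V] [Group G] {ρ : Representation ℂ G V}

theorem dual_evalAt (S : Subrepresentation (coordRep ρ)) (g : G) (x : V) :
    S.toRepresentation.dual g (evalAt S.toSubmodule x) = evalAt S.toSubmodule (ρ g x) := by
  ext f
  change ((f : coordRing V) : V → ℂ) (ρ g⁻¹⁻¹ x) = ((f : coordRing V) : V → ℂ) (ρ g x)
  rw [inv_inv]

theorem asGroupHom_smul_mem_zeroLocus_iff {f : coordRing V} {p : ℙ ℂ V} {g : G} :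
    ρ.asGroupHom g • p ∈ zeroLocus f ↔ p ∈ zeroLocus (coordRep ρ g⁻¹ f) := by
  induction p using Projectivization.ind with
  | h w hw =>
    rw [Projectivization.smul_mk, mk_mem_zeroLocus_iff, mk_mem_zeroLocus_iff]
    refine forall_congr' fun c => ?_
    change (f : V → ℂ) (c • ρ g w) = 0 ↔ (f : V → ℂ) (ρ g⁻¹⁻¹ (c • w)) = 0
    rw [inv_inv, map_smul]

theorem exists_subrepresentation_equiv_tensorPowerRep {v : ℙ ℂ V} {d : ℕ}
    {S : Subrepresentation (coordRep ρ)} (hS : S.toSubmodule ≤ homogeneousPart V d)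
    {x : V} (hx : x ∈ v.submodule) (hev : evalAt S.toSubmodule x ≠ 0) :
    ∃ T : Subrepresentation (restrictRep S.toRepresentation.dual (stabilizer ρ v)),
      Nonempty (T.toRepresentation.Equiv (tensorPowerRep (lineRep ρ v) d)) := by
  have finrank_tensorPower : finrank ℂ (⨂[ℂ]^d v.submodule) = 1 := by
    rw [finrank_piTensorProduct]
    simp only [v.finrank_submodule, Finset.prod_const_one]
  refine exists_subrepresentation_equiv_of_common_eigenvector _ _ finrank_tensorPower hev
    fun h => ?_
  obtain ⟨a, ha⟩ := (LinearMap.existsUnique_eq_smul_id_of_finrank_eq_one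
    v.finrank_submodule (lineRep ρ v h)).exists
  have hax : ρ (h : G) x = a • x := congrArg Subtype.val (LinearMap.congr_fun ha ⟨x, hx⟩)
  refine ⟨a ^ d, ?_, tensorPowerRep_eq_smul_id ha d⟩
  change S.toRepresentation.dual (h : G) (evalAt S.toSubmodule x) = _
  rw [dual_evalAt, hax, evalAt_smul hS]

theorem orbit_subset_zeroLocus {v : ℙ ℂ V} {S : Subrepresentation (coordRep ρ)}
    (hS : ∀ f ∈ S, v ∈ zeroLocus f) {f : coordRing V} (hf : f ∈ S) :
    orbit ρ v ⊆ zeroLocus f := by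
  rintro _ ⟨g, rfl⟩
  exact asGroupHom_smul_mem_zeroLocus_iff.2 (hS _ (S.apply_mem_toSubmodule g⁻¹ hf))

end Action

end OrbitClosure

open OrbitClosure in
theorem mainTheorem5_general {G V : Type*} [Group G] [AddCommGroup V] [Module ℂ V]
    [FiniteDimensional ℂ V] [TopologicalSpace V] [IsTopologicalAddGroup V] [ContinuousSMul ℂ V]
    [T2Space V] (ρ : Representation ℂ G V) (v : ℙ ℂ V) (d : ℕ) (S : Subrepresentation (coordRep ρ))
    (hd : S.toSubmodule ≤ homogeneousPart V d)
    (hT : ¬ ∃ T : Subrepresentation (restrictRep S.toRepresentation.dual (stabilizer ρ v)),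
      Nonempty (T.toRepresentation.Equiv (tensorPowerRep (lineRep ρ v) d))) :
    ∀ f ∈ S, f ∈ orbitClosureIdeal ρ v := by
  have evalAt_eq_zero (x : V) (hx : x ∈ v.submodule) : evalAt S.toSubmodule x = 0 := by
    by_contra hev
    exact hT (exists_subrepresentation_equiv_tensorPowerRep hd hx hev)
  have vanish_at_v : ∀ f ∈ S, v ∈ zeroLocus f := fun f hf x hx =>
    LinearMap.congr_fun (evalAt_eq_zero x hx) ⟨f, hf⟩
  intro f hf
  have vanish_on_closure : orbitClosure ρ v ⊆ zeroLocus f :=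
    closure_minimal (orbit_subset_zeroLocus vanish_at_v hf) (isClosed_zeroLocus f)
  exact mem_projectiveIdeal_of_subset_zeroLocus (hd hf) vanish_on_closure

theorem mainTheorem5 (n : ℕ) {V : Type*} [AddCommGroup V] [Module ℂ V] [FiniteDimensional ℂ V]
    [TopologicalSpace V] [IsTopologicalAddGroup V] [ContinuousSMul ℂ V] [T2Space V]
    (ρ : Representation ℂ (Matrix.GeneralLinearGroup (Fin n) ℂ) V) (v : ℙ ℂ V)
    (hv : OrbitClosure.CharacterizedByStabilizer ρ v) (d : ℕ)
    (S : Subrepresentation (OrbitClosure.coordRep ρ))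
    (hS : S ∈ OrbitClosure.stabilizerData ρ v d) :
    ∀ f ∈ S, f ∈ OrbitClosure.orbitClosureIdeal ρ v :=
  mainTheorem5_general ρ v d S hS.1 hS.2.2
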